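/- Let $n\ge 1$ and $m,p,L\ge 0$ be integers. Let $\Phi_{11}=\Phi_{11}^\top\in\mathbb R^{(n+p)\times(n+p)}$, $\Phi_{12}\in\mathbb R^{(n+p)\times L}$, $\Phi_{22}=\Phi_{22}^\top\in\mathbb R^{L\times L}$, $\Phi=\begin{bmatrix}\Phi_{11}&\Phi_{12}\\ \Phi_{12}^\top&\Phi_{22}\end{bmatrix}$, and assume that the noise set $$\mathcal N=\left\{Z\in\mathbb R^{(n+p)\times L}:\begin{bmatrix}I\\Z^\top\end{bmatrix}^\top\Phi\begin{bmatrix}I\\Z^\top\end{bmatrix}\ge 0\right\}$$ is bounded and has nonempty interior. Given data $U_-=[u(0)\ \cdots\ u(L-1)]\in\mathbb R^{m\times L}$, $X=[x(0)\ \cdots\ x(L)]\in\mathbb R^{n\times(L+1)}$, $Y_-=[y(0)\ \cdots\ y(L-1)]\in\mathbb R^{p\times L}$, put $X_-=[x(0)\ \cdots\ x(L-1)]$, $X_+=[x(1)\ \cdots\ x(L)]$, and let $\mathbf\Sigma$ be the set of all $(A,B,C,D)\in\mathbb R^{n\times n}\times\mathbb R^{n\times m}\times\mathbb R^{p\times n}\times\mathbb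 R^{p\times m}$ with $$\begin{bmatrix}X_+\\Y_-\end{bmatrix}-\begin{bmatrix}A&B\\C&D\end{bmatrix}\begin{bmatrix}X_-\\U_-\end{bmatrix}\in\mathcal N .$$ The data $(U_-,X,Y_-)$ are called informative for generalized Lyapunov balancing if there exist $P=P^\top>0$ and $Q=Q^\top>0$ such that $APA^\top-P+BB^\top<0$ and $A^\top QA-Q+C^\top C<0$ for all $(A,B,C,D)\in\mathbf\Sigma$. Define $$N=\begin{bmatrix}I&0&X_+\\0&I&Y_-\\0&0&-X_-\\0&0&-U_-\end{bmatrix}\Phi\begin{bmatrix}I&0&X_+\\0&I&Y_-\\0&0&-X_-\\0&0&-U_-\end{bmatrix}^\top,\qquad N_{\mathcal C}=\begin{bmatrix}I_n&0\\0&0\\0&I_{n+m}\end{bmatrix}^\top N\begin{bmatrix}I_n&0\\0&0\\0&I_{n+m}\end{bmatrix},$$ where the zero block row has height $p$, and, when $N$ is nonsingular, $$N^\sharp=\begin{bmatrix}0&-I_{n+m}\\I_{n+p}&0\end{bmatrix}N^{-1}\begin{bmatrix}0&-I_{n+p}\\I_{n+m}&0\end{bmatrix},\qquad N_{\mathcal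 O}=\begin{bmatrix}I_n&0\\0&0\\0&I_{n+p}\end{bmatrix}^\top N^\sharp\begin{bmatrix}I_n&0\\0&0\\0&I_{n+p}\end{bmatrix},$$ where the zero block row has height $m$. Suppose that the generalized Slater condition holds: there exists $\bar S\in\mathbb R^{(n+m)\times(n+p)}$ with $\begin{bmatrix}I\\\bar S\end{bmatrix}^\top N\begin{bmatrix}I\\\bar S\end{bmatrix}>0$. Then the data $(U_-,X,Y_-)$ are informative for generalized Lyapunov balancing if and only if the following three conditions hold: (i) $\begin{bmatrix}X_-\\U_-\end{bmatrix}$ has full row rank (in which case $N$ is nonsingular, so that (iii) is meaningful); (ii) there exist $P=P^\top>0$ and a scalar $\alpha>0$ such that $\operatorname{blkdiag}(P,-P,-I_m)-\alpha N_{\mathcal C}>0$; (iii) there exist $Q=Q^\top>0$ and a scalar $\beta>0$ such that $\operatorname{blkdiag}(Q,-Q,-I_p)-\beta N_{\mathcal O}>0$. Here, for symmetric matrices, $>0$ ($\ge0$, $<0$) means positive definite (positive semidefinite, negative definite). -/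

import Mathlib

open Matrix

noncomputable section

namespace GLB

/-- A discrete-time linear system `x(k+1) = A x(k) + B u(k)`, `y(k) = C x(k) + D u(k)` with
`n` states, `m` inputs and `p` outputs. -/
structure LinSys (n m p : ℕ) where
  A : Matrix (Fin n) (Fin n) ℝ
  B : Matrix (Fin n) (Fin m) ℝ
  C : Matrix (Fin p) (Fin n) ℝ
  D : Matrix (Fin p) (Fin m) ℝ

/-- The block matrix `[A, B; C, D]`. -/
def LinSys.toMatrix {n m p : ℕ} (S : LinSys n m p) :
    Matrix (Fin n ⊕ Fin p) (Fin n ⊕ Fin m) ℝ :=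
  fromBlocks S.A S.B S.C S.D

/-- The matrix `[I; S]ᵀ M [I; S]`. -/
def quadForm {a b : Type*} [Fintype a] [DecidableEq a] [Fintype b]
    (M : Matrix (a ⊕ b) (a ⊕ b) ℝ) (S : Matrix b a ℝ) : Matrix a a ℝ :=
  (fromRows (1 : Matrix a a ℝ) S)ᵀ * M * fromRows (1 : Matrix a a ℝ) S

section Data

variable {n m p L : ℕ}

/-- The states `x(0), …, x(L-1)`. -/
def stateMinus (X : Matrix (Fin n) (Fin (L + 1)) ℝ) : Matrix (Fin n) (Fin L) ℝ :=
  X.submatrix id Fin.castSucc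

/-- The states `x(1), …, x(L)`. -/
def statePlus (X : Matrix (Fin n) (Fin (L + 1)) ℝ) : Matrix (Fin n) (Fin L) ℝ :=
  X.submatrix id Fin.succ

/-- The symmetric matrix `[Φ₁₁, Φ₁₂; Φ₁₂ᵀ, Φ₂₂]`. -/
def noiseMatrix (Φ₁₁ : Matrix (Fin n ⊕ Fin p) (Fin n ⊕ Fin p) ℝ)
    (Φ₁₂ : Matrix (Fin n ⊕ Fin p) (Fin L) ℝ) (Φ₂₂ : Matrix (Fin L) (Fin L) ℝ) :
    Matrix ((Fin n ⊕ Fin p) ⊕ Fin L) ((Fin n ⊕ Fin p) ⊕ Fin L) ℝ :=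
  fromBlocks Φ₁₁ Φ₁₂ Φ₁₂ᵀ Φ₂₂

/-- The noise model: all `Z` with `[I; Zᵀ]ᵀ Φ [I; Zᵀ] ≥ 0`. -/
def noiseModel (Φ : Matrix ((Fin n ⊕ Fin p) ⊕ Fin L) ((Fin n ⊕ Fin p) ⊕ Fin L) ℝ) :
    Set (Matrix (Fin n ⊕ Fin p) (Fin L) ℝ) :=
  {Z | (quadForm Φ Zᵀ).PosSemidef}

/-- Boundedness of a set of real matrices (entrywise, equivalently in any norm). -/
def IsBoundedSet {a b : Type*} (S : Set (Matrix a b ℝ)) : Prop :=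
  ∃ c : ℝ, ∀ Z ∈ S, ∀ i j, |Z i j| ≤ c

/-- The set of all systems explaining the data `(U₋, X, Y₋)`. -/
def explainingSystems
    (Φ : Matrix ((Fin n ⊕ Fin p) ⊕ Fin L) ((Fin n ⊕ Fin p) ⊕ Fin L) ℝ)
    (U : Matrix (Fin m) (Fin L) ℝ) (X : Matrix (Fin n) (Fin (L + 1)) ℝ)
    (Y : Matrix (Fin p) (Fin L) ℝ) : Set (LinSys n m p) :=
  {S | fromRows (statePlus X) Y - S.toMatrix * fromRows (stateMinus X) U ∈ noiseModel Φ}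

/-- `P` is a generalized controllability Gramian of the system. -/
def IsCtrbGramian (S : LinSys n m p) (P : Matrix (Fin n) (Fin n) ℝ) : Prop :=
  P.PosDef ∧ (-(S.A * P * S.Aᵀ - P + S.B * S.Bᵀ)).PosDef

/-- `Q` is a generalized observability Gramian of the system. -/
def IsObsvGramian (S : LinSys n m p) (Q : Matrix (Fin n) (Fin n) ℝ) : Prop :=
  Q.PosDef ∧ (-(S.Aᵀ * Q * S.A - Q + S.Cᵀ * S.C)).PosDef

/-- The data are informative for generalized Lyapunov balancing. -/
def InformativeGLB
    (Φ : Matrix ((Fin n ⊕ Fin p) ⊕ Fin L) ((Fin n ⊕ Fin p) ⊕ Fin L) ℝ)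
    (U : Matrix (Fin m) (Fin L) ℝ) (X : Matrix (Fin n) (Fin (L + 1)) ℝ)
    (Y : Matrix (Fin p) (Fin L) ℝ) : Prop :=
  ∃ P Q : Matrix (Fin n) (Fin n) ℝ, P.PosDef ∧ Q.PosDef ∧
    ∀ S ∈ explainingSystems Φ U X Y, IsCtrbGramian S P ∧ IsObsvGramian S Q

/-- The matrix `[I, 0, X₊; 0, I, Y₋; 0, 0, -X₋; 0, 0, -U₋]`. -/
def dataFactor (U : Matrix (Fin m) (Fin L) ℝ) (X : Matrix (Fin n) (Fin (L + 1)) ℝ)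
    (Y : Matrix (Fin p) (Fin L) ℝ) :
    Matrix ((Fin n ⊕ Fin p) ⊕ (Fin n ⊕ Fin m)) ((Fin n ⊕ Fin p) ⊕ Fin L) ℝ :=
  fromBlocks 1 (fromRows (statePlus X) Y) 0 (-fromRows (stateMinus X) U)

/-- The data matrix `N`. -/
def dataMatrix
    (Φ : Matrix ((Fin n ⊕ Fin p) ⊕ Fin L) ((Fin n ⊕ Fin p) ⊕ Fin L) ℝ)
    (U : Matrix (Fin m) (Fin L) ℝ) (X : Matrix (Fin n) (Fin (L + 1)) ℝ)
    (Y : Matrix (Fin p) (Fin L) ℝ) :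
    Matrix ((Fin n ⊕ Fin p) ⊕ (Fin n ⊕ Fin m)) ((Fin n ⊕ Fin p) ⊕ (Fin n ⊕ Fin m)) ℝ :=
  dataFactor U X Y * Φ * (dataFactor U X Y)ᵀ

/-- The generalized Slater condition on `N`. -/
def GeneralizedSlater
    (N : Matrix ((Fin n ⊕ Fin p) ⊕ (Fin n ⊕ Fin m))
      ((Fin n ⊕ Fin p) ⊕ (Fin n ⊕ Fin m)) ℝ) : Prop :=
  ∃ S : Matrix (Fin n ⊕ Fin m) (Fin n ⊕ Fin p) ℝ, (quadForm N S).PosDef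

/-- The matrix `[I_n, 0; 0, 0; 0, I_{n+m}]`, whose zero block row has height `p`. -/
def selector (n p m : ℕ) :
    Matrix ((Fin n ⊕ Fin p) ⊕ (Fin n ⊕ Fin m)) (Fin n ⊕ (Fin n ⊕ Fin m)) ℝ :=
  fromBlocks (fromRows 1 0) 0 0 1

/-- The matrix `N_C`. -/
def ctrbMatrix
    (N : Matrix ((Fin n ⊕ Fin p) ⊕ (Fin n ⊕ Fin m))
      ((Fin n ⊕ Fin p) ⊕ (Fin n ⊕ Fin m)) ℝ) :
    Matrix (Fin n ⊕ (Fin n ⊕ Fin m)) (Fin n ⊕ (Fin n ⊕ Fin m)) ℝ :=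
  (selector n p m)ᵀ * N * selector n p m

/-- The dualized matrix `N^♯ = [0, -I; I, 0] N⁻¹ [0, -I; I, 0]`. -/
def dualMatrix
    (N : Matrix ((Fin n ⊕ Fin p) ⊕ (Fin n ⊕ Fin m))
      ((Fin n ⊕ Fin p) ⊕ (Fin n ⊕ Fin m)) ℝ) :
    Matrix ((Fin n ⊕ Fin m) ⊕ (Fin n ⊕ Fin p)) ((Fin n ⊕ Fin m) ⊕ (Fin n ⊕ Fin p)) ℝ :=
  (fromBlocks 0 (-1) 1 0 :
      Matrix ((Fin n ⊕ Fin m) ⊕ (Fin n ⊕ Fin p)) ((Fin n ⊕ Fin p) ⊕ (Fin n ⊕ Fin m)) ℝ) *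
    N⁻¹ *
    (fromBlocks 0 (-1) 1 0 :
      Matrix ((Fin n ⊕ Fin p) ⊕ (Fin n ⊕ Fin m)) ((Fin n ⊕ Fin m) ⊕ (Fin n ⊕ Fin p)) ℝ)

/-- The matrix `N_O`. -/
def obsvMatrix
    (N : Matrix ((Fin n ⊕ Fin p) ⊕ (Fin n ⊕ Fin m))
      ((Fin n ⊕ Fin p) ⊕ (Fin n ⊕ Fin m)) ℝ) :
    Matrix (Fin n ⊕ (Fin n ⊕ Fin p)) (Fin n ⊕ (Fin n ⊕ Fin p)) ℝ :=
  (selector n m p)ᵀ * dualMatrix N * selector n m p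

/-- The block diagonal matrix `blkdiag(P, -P, -I_k)`. -/
def gramBlock (k : ℕ) (P : Matrix (Fin n) (Fin n) ℝ) :
    Matrix (Fin n ⊕ (Fin n ⊕ Fin k)) (Fin n ⊕ (Fin n ⊕ Fin k)) ℝ :=
  fromBlocks P 0 0 (fromBlocks (-P) 0 0 (-1))

end Data

end GLB

end

open Matrix

namespace GLB

/-! Write T for the transpose of [A, B; C, D]. A system explains the data iff the form of N is
nonnegative on every (v, Tv). The controllability inequality at v sees only T(v, 0) = (Aᵀv, Bᵀv).
Boundedness of the noise set makes Φ₂₂ negative definite, and full row rank passes this on to the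
lower right block of N. Together with the Slater point, each vector (w, z) with w ≠ 0 and
nonnegative N-form is then (w, Tw) for some solution T (`exists_mulVec_eq_of_bil_nonneg`).
Informativity thus becomes an implication between two quadratic forms, and the strict S-lemma
(`exists_posDef_sub_smul`) turns it into (ii). Full row rank is necessary: if ξ is in the left
kernel of the data, every T + ξωᵀ is again a solution, and Lyapunov inequalities bound this family
only when ξ = 0. Observability involves Tᵀ instead. Dualization shows that Tᵀ solves the inequality
of `dualMatrix N`, which has the same sign properties, so the same argument with m and p exchanged
yields (iii). -/

lemma isHermitian_iff_isSymm {ι : Type*} {M : Matrix ι ι ℝ} : M.IsHermitian ↔ M.IsSymm := by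
  rw [IsHermitian, conjTranspose_eq_transpose_of_trivial, IsSymm]

/-! ### Calculus of bilinear forms. -/

section BilinearForm

variable {a b : Type*} [Fintype a] [Fintype b]

/-- The bilinear form `xᵀ M y`. -/
def bil (M : Matrix a b ℝ) (x : a → ℝ) (y : b → ℝ) : ℝ := x ⬝ᵥ M *ᵥ y

lemma bil_add_left (M : Matrix a b ℝ) (x x' : a → ℝ) (y : b → ℝ) :
    bil M (x + x') y = bil M x y + bil M x' y := add_dotProduct _ _ _

lemma bil_add_right (M : Matrix a b ℝ) (x : a → ℝ) (y y' : b → ℝ) :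
    bil M x (y + y') = bil M x y + bil M x y' := by
  simp [bil, mulVec_add]

lemma bil_smul_left (M : Matrix a b ℝ) (t : ℝ) (x : a → ℝ) (y : b → ℝ) :
    bil M (t • x) y = t * bil M x y := by
  simp [bil]

lemma bil_smul_right (M : Matrix a b ℝ) (t : ℝ) (x : a → ℝ) (y : b → ℝ) :
    bil M x (t • y) = t * bil M x y := by
  simp [bil, mulVec_smul]

lemma bil_neg_left (M : Matrix a b ℝ) (x : a → ℝ) (y : b → ℝ) :
    bil M (-x) y = -bil M x y := by
  simp [bil]

lemma bil_neg_right (M : Matrix a b ℝ) (x : a → ℝ) (y : b → ℝ) :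
    bil M x (-y) = -bil M x y := by
  simp [bil, mulVec_neg]

@[simp] lemma bil_zero_left (M : Matrix a b ℝ) (y : b → ℝ) : bil M 0 y = 0 := by
  simp [bil]

lemma bil_transpose (M : Matrix a b ℝ) (x : b → ℝ) (y : a → ℝ) :
    bil Mᵀ x y = bil M y x := by
  rw [bil, bil, mulVec_transpose, dotProduct_comm, dotProduct_mulVec]

lemma bil_comm {M : Matrix a a ℝ} (hM : M.IsSymm) (x y : a → ℝ) : bil M x y = bil M y x := by
  rw [← bil_transpose, hM.eq]

lemma bil_sub (M N : Matrix a b ℝ) (x : a → ℝ) (y : b → ℝ) :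
    bil (M - N) x y = bil M x y - bil N x y := by
  simp [bil, sub_mulVec]

lemma bil_add (M N : Matrix a b ℝ) (x : a → ℝ) (y : b → ℝ) :
    bil (M + N) x y = bil M x y + bil N x y := by
  simp [bil, add_mulVec]

lemma bil_neg (M : Matrix a b ℝ) (x : a → ℝ) (y : b → ℝ) :
    bil (-M) x y = -bil M x y := by
  simp [bil, neg_mulVec]

lemma bil_smul (t : ℝ) (M : Matrix a b ℝ) (x : a → ℝ) (y : b → ℝ) :
    bil (t • M) x y = t * bil M x y := by
  simp [bil, smul_mulVec]

lemma bil_one [DecidableEq a] (x y : a → ℝ) : bil (1 : Matrix a a ℝ) x y = x ⬝ᵥ y := by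
  simp [bil]

lemma bil_congr {c d : Type*} [Fintype c] [Fintype d] (F : Matrix a c ℝ) (M : Matrix c d ℝ)
    (G : Matrix b d ℝ) (x : a → ℝ) (y : b → ℝ) :
    bil (F * M * Gᵀ) x y = bil M (Fᵀ *ᵥ x) (Gᵀ *ᵥ y) := by
  rw [bil, bil, ← mulVec_mulVec, ← mulVec_mulVec, dotProduct_mulVec, mulVec_transpose F]

lemma bil_add_self {M : Matrix a a ℝ} (hM : M.IsSymm) (x y : a → ℝ) :
    bil M (x + y) (x + y) = bil M x x + 2 * bil M x y + bil M y y := by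
  rw [bil_add_left, bil_add_right, bil_add_right, bil_comm hM y x]; ring

lemma bil_add_smul_self {M : Matrix a a ℝ} (hM : M.IsSymm) (x y : a → ℝ) (t : ℝ) :
    bil M (x + t • y) (x + t • y) = bil M x x + 2 * t * bil M x y + t ^ 2 * bil M y y := by
  rw [bil_add_self hM, bil_smul_right, bil_smul_right, bil_smul_left]; ring

lemma posDef_iff_bil {M : Matrix a a ℝ} :
    M.PosDef ↔ M.IsSymm ∧ ∀ x, x ≠ 0 → 0 < bil M x x := by
  rw [posDef_iff_dotProduct_mulVec, isHermitian_iff_isSymm]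
  simp [bil]

lemma posSemidef_iff_bil {M : Matrix a a ℝ} :
    M.PosSemidef ↔ M.IsSymm ∧ ∀ x, 0 ≤ bil M x x := by
  rw [posSemidef_iff_dotProduct_mulVec, isHermitian_iff_isSymm]
  simp [bil]

lemma continuous_bil_self (M : Matrix a a ℝ) : Continuous fun x => bil M x x := by
  unfold bil dotProduct mulVec dotProduct
  fun_prop

lemma dotProduct_self_pos {x : a → ℝ} (hx : x ≠ 0) : 0 < x ⬝ᵥ x := by
  have h := (dotProduct_star_self_pos_iff (v := x)).2 hx
  simpa using h

end BilinearForm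

/-! ### The S-lemma, nonstrict and strict. -/

section SLemma

variable {a : Type*} [Fintype a]

/-- The quadratic t ↦ N(x + ty) has roots of opposite sign, and M is positive at both. The
combination of these two values that cancels the cross term M(x, y) is the claim, since the product
of the roots is N(x) / N(y). -/
lemma bil_div_le_bil_div {M N : Matrix a a ℝ} (hM : M.IsSymm) (hN : N.IsSymm)
    (h : ∀ x, x ≠ 0 → 0 ≤ bil N x x → 0 < bil M x x) {x y : a → ℝ}
    (hx : 0 < bil N x x) (hy : bil N y y < 0) :
    bil M y y / bil N y y ≤ bil M x x / bil N x x := by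
  obtain ⟨s, hs0, hs⟩ : ∃ s, 0 ≤ s ∧ s ^ 2 = bil N x y ^ 2 - bil N x x * bil N y y :=
    ⟨_, Real.sqrt_nonneg _, Real.sq_sqrt (by nlinarith [sq_nonneg (bil N x y)])⟩
  have hsb : |bil N x y| < s := by
    apply abs_lt_of_sq_lt_sq _ hs0
    nlinarith
  have hmem : ∀ t : ℝ, bil N x x + 2 * t * bil N x y + t ^ 2 * bil N y y = 0 →
      0 < bil M x x + 2 * t * bil M x y + t ^ 2 * bil M y y := by
    intro t ht
    rw [← bil_add_smul_self hN] at ht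
    rw [← bil_add_smul_self hM]
    refine h _ (fun h0 => ?_) ht.ge
    have hxy : x = (-t) • y := by rw [neg_smul]; exact eq_neg_of_add_eq_zero_left h0
    rw [hxy, bil_smul_left, bil_smul_right] at hx
    nlinarith [sq_nonneg t]
  have hy' := hy.ne
  obtain ⟨hb1, hb2⟩ := abs_lt.1 hsb
  set t₁ := (-bil N x y + s) / bil N y y with ht₁
  set t₂ := (-bil N x y - s) / bil N y y with ht₂
  have e₁ : t₁ < 0 := div_neg_of_pos_of_neg (by linarith) hy
  have e₂ : 0 < t₂ := div_pos_of_neg_of_neg (by linarith) hy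
  have e₃ : t₁ * t₂ = bil N x x / bil N y y := by
    rw [ht₁, ht₂]; field_simp; linear_combination -hs
  have f₁ := hmem t₁ (by rw [ht₁]; field_simp; linear_combination hs)
  have f₂ := hmem t₂ (by rw [ht₂]; field_simp; linear_combination hs)
  have key : 0 < (t₂ - t₁) * (bil M x x - t₁ * t₂ * bil M y y) := by
    have g₁ := mul_pos e₂ f₁
    have g₂ := mul_pos (neg_pos.2 e₁) f₂
    linear_combination g₁ + g₂
  have key' : 0 < bil M x x - t₁ * t₂ * bil M y y :=
    (mul_pos_iff_of_pos_left (by linarith)).1 key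
  rw [e₃] at key'
  rw [le_div_iff₀ hx]
  have : bil N x x / bil N y y * bil M y y = bil M y y / bil N y y * bil N x x := by
    field_simp
  linarith

/-- The S-lemma for homogeneous quadratic inequalities. -/
theorem exists_bil_nonneg_of_forall_pos {M N : Matrix a a ℝ} (hM : M.IsSymm) (hN : N.IsSymm)
    (hpos : ∃ x, 0 < bil N x x) (h : ∀ x, x ≠ 0 → 0 ≤ bil N x x → 0 < bil M x x) :
    ∃ α : ℝ, ∀ x, α * bil N x x ≤ bil M x x := by
  by_cases hneg : ∃ y, bil N y y < 0
  · obtain ⟨x₀, hx₀⟩ := hpos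
    obtain ⟨y₀, hy₀⟩ := hneg
    let R : Set ℝ := (fun y => bil M y y / bil N y y) '' {y | bil N y y < 0}
    have hne : R.Nonempty := ⟨_, y₀, hy₀, rfl⟩
    have hub : ∀ x, 0 < bil N x x → ∀ r ∈ R, r ≤ bil M x x / bil N x x := by
      rintro x hx _ ⟨y, hy, rfl⟩
      exact bil_div_le_bil_div hM hN h hx hy
    -- Ratios M/N over N < 0 lie below those over N > 0, so their supremum separates the two.
    refine ⟨sSup R, fun x => ?_⟩
    rcases lt_trichotomy (bil N x x) 0 with hx | hx | hx
    · have := le_csSup ⟨_, hub x₀ hx₀⟩ ⟨x, hx, rfl⟩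
      exact (div_le_iff_of_neg hx).1 this
    · rw [hx, mul_zero]
      by_cases h0 : x = 0
      · simp [h0]
      · exact (h x h0 hx.ge).le
    · exact (le_div_iff₀ hx).1 (csSup_le hne (hub x hx))
  · push Not at hneg
    refine ⟨0, fun x => ?_⟩
    by_cases h0 : x = 0
    · simp [h0]
    · simpa using (h x h0 (hneg x)).le

/-- The strict S-lemma for homogeneous quadratic inequalities. -/
theorem exists_posDef_sub_smul {M N : Matrix a a ℝ} (hM : M.IsSymm) (hN : N.IsSymm)
    (hpos : ∃ x, 0 < bil N x x) (h : ∀ x, x ≠ 0 → 0 ≤ bil N x x → 0 < bil M x x) :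
    ∃ α : ℝ, (M - α • N).PosDef := by
  classical
  let K : Set (a → ℝ) := Metric.sphere 0 1 ∩ {x | 0 ≤ bil N x x}
  have hK : IsCompact K := (isCompact_sphere 0 1).inter_right
    (isClosed_le continuous_const (continuous_bil_self N))
  have hne0 : ∀ x : a → ℝ, ‖x‖ = 1 → x ≠ 0 := fun x hx h0 => by simp [h0] at hx
  have hnorm : ∀ x : a → ℝ, x ≠ 0 → ‖‖x‖⁻¹ • x‖ = 1 := fun x hx => norm_smul_inv_norm hx
  have hscale : ∀ x : a → ℝ, x ≠ 0 → 0 ≤ bil N x x → ‖x‖⁻¹ • x ∈ K := by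
    intro x hx hNx
    refine ⟨by simp [hnorm x hx], ?_⟩
    change 0 ≤ bil N _ _
    rw [bil_smul_left, bil_smul_right]
    positivity
  have hKne : K.Nonempty := by
    obtain ⟨x, hx⟩ := hpos
    exact ⟨_, hscale x (fun h0 => by simp [h0] at hx) hx.le⟩
  -- The sphere is that of the sup norm. The quotient is homogeneous of degree 0, so its minimum δ
  -- on K bounds M below by δ(x ⬝ᵥ x) on the whole cone N ≥ 0; half of δ is then given up for
  -- strictness.
  have hcont : ContinuousOn (fun x => bil M x x / (x ⬝ᵥ x)) K := by
    refine (continuous_bil_self M).continuousOn.div ?_ ?_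
    · simpa only [bil_one] using (continuous_bil_self (1 : Matrix a a ℝ)).continuousOn
    · intro x hx
      exact (dotProduct_self_pos (hne0 x (by simpa using hx.1))).ne'
  obtain ⟨z, hzK, hz⟩ := hK.exists_isMinOn hKne hcont
  have hz0 : z ≠ 0 := hne0 z (by simpa using hzK.1)
  obtain ⟨δ, hδ⟩ : ∃ δ, δ = bil M z z / (z ⬝ᵥ z) := ⟨_, rfl⟩
  have hδ0 : 0 < δ := hδ ▸ div_pos (h z hz0 hzK.2) (dotProduct_self_pos hz0)
  have hsymm : (M - (δ / 2) • (1 : Matrix a a ℝ)).IsSymm :=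
    hM.sub ((isSymm_one).smul _)
  obtain ⟨α, hα⟩ := exists_bil_nonneg_of_forall_pos hsymm hN hpos (fun x hx hNx => by
    have h1 : δ ≤ _ := hδ ▸ isMinOn_iff.1 hz _ (hscale x hx hNx)
    have hx' : 0 < ‖x‖⁻¹ := by positivity
    rw [bil_smul_left, bil_smul_right, smul_dotProduct, dotProduct_smul, smul_eq_mul, smul_eq_mul,
      mul_div_mul_left _ _ hx'.ne', mul_div_mul_left _ _ hx'.ne',
      le_div_iff₀ (dotProduct_self_pos hx)] at h1
    rw [bil_sub, bil_smul, bil_one]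
    nlinarith [dotProduct_self_pos hx])
  refine ⟨α, posDef_iff_bil.2 ⟨hM.sub (hN.smul _), fun x hx => ?_⟩⟩
  have := hα x
  rw [bil_sub, bil_smul, bil_one] at this
  rw [bil_sub, bil_smul]
  nlinarith [dotProduct_self_pos hx]

end SLemma

/-! ### Quadratic matrix inequalities and their solutions. -/

section BlockForm

variable {a b : Type*} [Fintype a]

lemma sumElim_eq_add (u : a ⊕ b → ℝ) (Z : Matrix b a ℝ) :
    u = Sum.elim (u ∘ Sum.inl) (Z *ᵥ (u ∘ Sum.inl)) +
      Sum.elim (0 : a → ℝ) (u ∘ Sum.inr - Z *ᵥ (u ∘ Sum.inl)) := by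
  ext (i | i) <;> simp

variable [Fintype b]

lemma bil_nonpos_of_neg {N : Matrix (a ⊕ b) (a ⊕ b) ℝ}
    (hneg : ∀ d, d ≠ 0 → bil N (Sum.elim (0 : a → ℝ) d) (Sum.elim (0 : a → ℝ) d) < 0)
    (d : b → ℝ) :
    bil N (Sum.elim (0 : a → ℝ) d) (Sum.elim (0 : a → ℝ) d) ≤ 0 := by
  by_cases hd : d = 0
  · simp [hd]
  · exact (hneg d hd).le

lemma dotProduct_orthogonal (Z : Matrix b a ℝ) (v : a → ℝ) (w : b → ℝ) :
    Sum.elim v (Z *ᵥ v) ⬝ᵥ Sum.elim (-(Zᵀ *ᵥ w)) w = 0 := by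
  rw [sumElim_dotProduct_sumElim, dotProduct_neg, mulVec_transpose, dotProduct_comm v,
    ← dotProduct_mulVec, dotProduct_comm w]
  ring

/-- If the second block row of `N u` vanishes then `uᵀ N u > 0`. -/
lemma bil_pos_of_mulVec_eq {N : Matrix (a ⊕ b) (a ⊕ b) ℝ} (hN : N.IsSymm)
    (hneg : ∀ d, d ≠ 0 → bil N (Sum.elim (0 : a → ℝ) d) (Sum.elim (0 : a → ℝ) d) < 0)
    {S₀ : Matrix b a ℝ}
    (hpos : ∀ v, v ≠ 0 → 0 < bil N (Sum.elim v (S₀ *ᵥ v)) (Sum.elim v (S₀ *ᵥ v)))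
    {u : a ⊕ b → ℝ} (hu : u ≠ 0) {z : a → ℝ} (hz : N *ᵥ u = Sum.elim z 0) :
    0 < bil N u u := by
  set v := u ∘ Sum.inl with hv
  set d := u ∘ Sum.inr - S₀ *ᵥ v with hd
  have hdec : u = Sum.elim v (S₀ *ᵥ v) + Sum.elim (0 : a → ℝ) d := sumElim_eq_add u S₀
  have h1 : bil N (Sum.elim (0 : a → ℝ) d) u = 0 := by
    rw [bil, hz, sumElim_dotProduct_sumElim]; simp
  -- Since (0, d) is N-orthogonal to u, the form at u is its value on the graph of S₀ minus its
  -- value at (0, d).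
  have h2 : bil N (Sum.elim v (S₀ *ᵥ v)) (Sum.elim v (S₀ *ᵥ v)) =
      bil N u u + bil N (Sum.elim (0 : a → ℝ) d) (Sum.elim (0 : a → ℝ) d) := by
    have : Sum.elim v (S₀ *ᵥ v) = u + (-1 : ℝ) • Sum.elim (0 : a → ℝ) d := by
      rw [hdec]; simp
    rw [this, bil_add_smul_self hN, bil_comm hN u (Sum.elim (0 : a → ℝ) d), h1]; ring
  have h3 := bil_nonpos_of_neg hneg d
  by_cases hv0 : v = 0
  · have hd0 : d ≠ 0 := fun h0 => hu (by rw [hdec, h0, hv0]; simp)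
    have := hneg d hd0
    have h4 : (0 : ℝ) =
        bil N u u + bil N (Sum.elim (0 : a → ℝ) d) (Sum.elim (0 : a → ℝ) d) := by
      rw [← h2, hv0]; simp
    linarith
  · linarith [hpos v hv0]

/-- The representing vector g can serve as a factor of a rank-one perturbation of Z. -/
lemma exists_dotProduct_eq_bil (M : Matrix (a ⊕ b) (a ⊕ b) ℝ) (Z : Matrix b a ℝ)
    (y : a ⊕ b → ℝ) : ∃ g : a → ℝ, ∀ v, g ⬝ᵥ v = bil M (Sum.elim v (Z *ᵥ v)) y := by
  refine ⟨(M *ᵥ y) ∘ Sum.inl + Zᵀ *ᵥ ((M *ᵥ y) ∘ Sum.inr), fun v => ?_⟩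
  have h : bil M (Sum.elim v (Z *ᵥ v)) y =
      v ⬝ᵥ ((M *ᵥ y) ∘ Sum.inl) + Z *ᵥ v ⬝ᵥ ((M *ᵥ y) ∘ Sum.inr) := by
    rw [← sumElim_dotProduct_sumElim, Sum.elim_comp_inl_inr]
    rfl
  rw [h, add_dotProduct, mulVec_transpose, ← dotProduct_mulVec, dotProduct_comm v,
    dotProduct_comm (Z *ᵥ v)]

/-- A vector inequality extends to a matrix solution of a quadratic matrix inequality. -/
theorem exists_mulVec_eq_of_bil_nonneg [DecidableEq b] {K : Matrix (a ⊕ b) (a ⊕ b) ℝ}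
    (hK : K.IsSymm)
    (hneg : ∀ d, d ≠ 0 → bil K (Sum.elim (0 : a → ℝ) d) (Sum.elim (0 : a → ℝ) d) < 0)
    {S₀ : Matrix b a ℝ}
    (hpos : ∀ v, v ≠ 0 → 0 < bil K (Sum.elim v (S₀ *ᵥ v)) (Sum.elim v (S₀ *ᵥ v)))
    {w : a → ℝ} {z : b → ℝ} (hw : w ≠ 0) (hwz : 0 ≤ bil K (Sum.elim w z) (Sum.elim w z)) :
    ∃ S : Matrix b a ℝ, S *ᵥ w = z ∧
      ∀ v, 0 ≤ bil K (Sum.elim v (S *ᵥ v)) (Sum.elim v (S *ᵥ v)) := by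
  have hdet : IsUnit K.toBlocks₂₂ := by
    rw [← mulVec_injective_iff_isUnit, ← coe_mulVecLin, injective_iff_map_eq_zero]
    intro d hd
    by_contra hd0
    have := hneg d hd0
    rw [coe_mulVecLin] at hd
    rw [← fromBlocks_toBlocks K, bil, fromBlocks_mulVec, sumElim_dotProduct_sumElim] at this
    simp [hd] at this
  -- Completing the square: around the center Z the form splits into the Schur complement Ψ,
  -- positive definite by the Slater point, and the negative definite lower right block.
  set Z : Matrix b a ℝ := -(K.toBlocks₂₂⁻¹ * K.toBlocks₂₁) with hZ
  have horth : ∀ v d, bil K (Sum.elim (0 : a → ℝ) d) (Sum.elim v (Z *ᵥ v)) = 0 := by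
    intro v d
    have h1 : K.toBlocks₂₂ * Z = -K.toBlocks₂₁ := by
      rw [hZ, Matrix.mul_neg, mul_nonsing_inv_cancel_left _ _ ((isUnit_iff_isUnit_det _).1 hdet)]
    rw [bil, ← fromBlocks_toBlocks K, fromBlocks_mulVec, sumElim_dotProduct_sumElim]
    simp [h1, neg_mulVec]
  obtain ⟨Ψ, hΨ⟩ : ∃ Ψ : (a → ℝ) → (a → ℝ) → ℝ, Ψ = fun v v' =>
    bil K (Sum.elim v (Z *ᵥ v)) (Sum.elim v' (Z *ᵥ v')) := ⟨_, rfl⟩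
  have hadd : ∀ v d, Sum.elim v (Z *ᵥ v + d) =
      Sum.elim v (Z *ᵥ v) + Sum.elim (0 : a → ℝ) d := by
    intro v d; ext (i | i) <;> simp
  have hsplit : ∀ v d, bil K (Sum.elim v (Z *ᵥ v + d)) (Sum.elim v (Z *ᵥ v + d)) =
      Ψ v v + bil K (Sum.elim (0 : a → ℝ) d) (Sum.elim (0 : a → ℝ) d) := by
    intro v d
    rw [hadd, bil_add_self hK, bil_comm hK _ (Sum.elim (0 : a → ℝ) d), horth, hΨ]
    ring
  have hΨpos : ∀ v, v ≠ 0 → 0 < Ψ v v := by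
    intro v hv
    have h1 := hpos v hv
    have h2 := hsplit v (S₀ *ᵥ v - Z *ᵥ v)
    rw [add_sub_cancel] at h2
    linarith [bil_nonpos_of_neg hneg (S₀ *ᵥ v - Z *ᵥ v)]
  have hcomb : ∀ (v : a → ℝ) (t : ℝ), Sum.elim (v + t • w) (Z *ᵥ (v + t • w)) =
      Sum.elim v (Z *ᵥ v) + t • Sum.elim w (Z *ᵥ w) := by
    intro v t; ext (i | i) <;> simp [mulVec_add, mulVec_smul]
  have hquad : ∀ v t, 0 ≤ Ψ v v + 2 * t * Ψ v w + t ^ 2 * Ψ w w := by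
    intro v t
    rw [hΨ]
    dsimp only
    rw [← bil_add_smul_self hK, ← hcomb]
    by_cases h0 : v + t • w = 0
    · rw [h0]; simp
    · have := hΨpos _ h0
      rw [hΨ] at this
      exact this.le
  have hww := hΨpos w hw
  set d := z - Z *ᵥ w with hd
  have hdw : 0 ≤ Ψ w w + bil K (Sum.elim (0 : a → ℝ) d) (Sum.elim (0 : a → ℝ) d) := by
    rw [← hsplit, hd, add_sub_cancel]; exact hwz
  -- The solution is Z + d gᵀ, with g the Ψ-orthogonal projection coefficient onto w, so that g ⬝ᵥ w
  -- = 1.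
  obtain ⟨g, hg⟩ : ∃ g : a → ℝ, ∀ v, g ⬝ᵥ v = Ψ v w / Ψ w w := by
    obtain ⟨g, hg⟩ := exists_dotProduct_eq_bil K Z (Sum.elim w (Z *ᵥ w))
    refine ⟨(Ψ w w)⁻¹ • g, fun v => ?_⟩
    rw [smul_dotProduct, hg, hΨ, smul_eq_mul, div_eq_inv_mul]
  refine ⟨Z + vecMulVec d g, ?_, fun v => ?_⟩
  · rw [add_mulVec, vecMulVec_mulVec, hg, div_self hww.ne', hd]
    simp
  · have h1 : (Z + vecMulVec d g) *ᵥ v = Z *ᵥ v + (g ⬝ᵥ v) • d := by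
      rw [add_mulVec, vecMulVec_mulVec]; simp
    have h2 : (Sum.elim (0 : a → ℝ) ((g ⬝ᵥ v) • d) : a ⊕ b → ℝ) =
        (g ⬝ᵥ v) • Sum.elim (0 : a → ℝ) d := by
      ext (i | i) <;> simp
    rw [h1, hsplit, h2, bil_smul_left, bil_smul_right]
    -- Cauchy–Schwarz for Ψ: Ψ(v) ≥ (g ⬝ᵥ v)² Ψ(w), while `hdw` bounds the loss in the direction d
    -- by Ψ(w).
    have h3 := hquad v (-(g ⬝ᵥ v))
    have h4 : Ψ v w = (g ⬝ᵥ v) * Ψ w w := by rw [hg]; field_simp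
    rw [h4] at h3
    nlinarith [mul_nonneg (sq_nonneg (g ⬝ᵥ v)) hdw]

end BlockForm

/-! ### Dualization through the inverse matrix. -/

section Duality

variable {a b : Type*} [Fintype a] [Fintype b] [DecidableEq a] [DecidableEq b]
  {N : Matrix (a ⊕ b) (a ⊕ b) ℝ}

lemma bil_inv_mulVec (hN : N.IsSymm) (hdet : IsUnit N.det) (x y : a ⊕ b → ℝ) :
    bil N⁻¹ (N *ᵥ x) y = x ⬝ᵥ y := by
  have hsymm : N⁻¹.IsSymm := by
    rw [IsSymm, transpose_nonsing_inv, hN.eq]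
  rw [bil_comm hsymm, bil, mulVec_mulVec, nonsing_inv_mul _ hdet, one_mulVec, dotProduct_comm]

lemma isUnit_det_of_bil (hN : N.IsSymm)
    (hneg : ∀ d, d ≠ 0 → bil N (Sum.elim (0 : a → ℝ) d) (Sum.elim (0 : a → ℝ) d) < 0)
    {S₀ : Matrix b a ℝ}
    (hpos : ∀ v, v ≠ 0 → 0 < bil N (Sum.elim v (S₀ *ᵥ v)) (Sum.elim v (S₀ *ᵥ v))) :
    IsUnit N.det := by
  rw [← isUnit_iff_isUnit_det, ← mulVec_injective_iff_isUnit, ← coe_mulVecLin,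
    injective_iff_map_eq_zero]
  intro u hu
  by_contra hu0
  rw [coe_mulVecLin] at hu
  have := bil_pos_of_mulVec_eq hN hneg hpos hu0 (z := 0) (by rw [hu]; simp)
  rw [bil, hu] at this
  simp at this

lemma bil_inv_pos (hN : N.IsSymm)
    (hneg : ∀ d, d ≠ 0 → bil N (Sum.elim (0 : a → ℝ) d) (Sum.elim (0 : a → ℝ) d) < 0)
    {S₀ : Matrix b a ℝ}
    (hpos : ∀ v, v ≠ 0 → 0 < bil N (Sum.elim v (S₀ *ᵥ v)) (Sum.elim v (S₀ *ᵥ v)))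
    {z : a → ℝ} (hz : z ≠ 0) : 0 < bil N⁻¹ (Sum.elim z 0) (Sum.elim z 0) := by
  have hdet := isUnit_det_of_bil hN hneg hpos
  set u := N⁻¹ *ᵥ Sum.elim z 0 with hu
  have hNu : N *ᵥ u = Sum.elim z 0 := by
    rw [hu, mulVec_mulVec, mul_nonsing_inv _ hdet, one_mulVec]
  have hu0 : u ≠ 0 := by
    intro h0
    rw [h0, mulVec_zero] at hNu
    exact hz (funext fun i => (congrFun hNu (Sum.inl i)).symm)
  have := bil_pos_of_mulVec_eq hN hneg hpos hu0 hNu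
  rwa [← hNu, bil_inv_mulVec hN hdet]

/-- With y = (-Zᵀw, w), the vector u = N⁻¹y is N-orthogonal to the graph of Z because y is
orthogonal to it. Splitting u into a graph part and (0, d) gives the identity by Pythagoras. -/
lemma exists_bil_inv_eq (hN : N.IsSymm) (hdet : IsUnit N.det) (Z : Matrix b a ℝ) (w : b → ℝ) :
    ∃ (v : a → ℝ) (d : b → ℝ), (w ≠ 0 → v = 0 → d ≠ 0) ∧
      bil N⁻¹ (Sum.elim (-(Zᵀ *ᵥ w)) w) (Sum.elim (-(Zᵀ *ᵥ w)) w) =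
        bil N (Sum.elim (0 : a → ℝ) d) (Sum.elim (0 : a → ℝ) d) -
          bil N (Sum.elim v (Z *ᵥ v)) (Sum.elim v (Z *ᵥ v)) := by
  set y : a ⊕ b → ℝ := Sum.elim (-(Zᵀ *ᵥ w)) w with hy
  set u := N⁻¹ *ᵥ y with hu
  have hNu : N *ᵥ u = y := by
    rw [hu, mulVec_mulVec, mul_nonsing_inv _ hdet, one_mulVec]
  set v := u ∘ Sum.inl with hv
  set d := u ∘ Sum.inr - Z *ᵥ v with hd
  have hdec : u = Sum.elim v (Z *ᵥ v) + Sum.elim (0 : a → ℝ) d := sumElim_eq_add u Z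
  have h1 : bil N (Sum.elim v (Z *ᵥ v)) u = 0 := by
    rw [bil, hNu, dotProduct_orthogonal]
  have h2 : Sum.elim (0 : a → ℝ) d = u + (-1 : ℝ) • Sum.elim v (Z *ᵥ v) := by
    rw [hdec]; simp
  refine ⟨v, d, fun hw hv0 hd0 => hw ?_, ?_⟩
  · have hu0 : u = 0 := by rw [hdec, hv0, hd0]; simp
    rw [hu0, mulVec_zero] at hNu
    exact funext fun i => (congrFun hNu (Sum.inr i)).symm
  · rw [h2, bil_add_smul_self hN, bil_comm hN u (Sum.elim v (Z *ᵥ v)), h1, ← hNu,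
      bil_inv_mulVec hN hdet]
    change bil N u u = _
    ring

/-- Dualization of a quadratic matrix inequality. -/
theorem bil_inv_nonpos (hN : N.IsSymm) (hdet : IsUnit N.det)
    (hneg : ∀ d, d ≠ 0 → bil N (Sum.elim (0 : a → ℝ) d) (Sum.elim (0 : a → ℝ) d) < 0)
    {Z : Matrix b a ℝ}
    (hZ : ∀ v, 0 ≤ bil N (Sum.elim v (Z *ᵥ v)) (Sum.elim v (Z *ᵥ v))) (w : b → ℝ) :
    bil N⁻¹ (Sum.elim (-(Zᵀ *ᵥ w)) w) (Sum.elim (-(Zᵀ *ᵥ w)) w) ≤ 0 := by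
  obtain ⟨v, d, -, h⟩ := exists_bil_inv_eq hN hdet Z w
  linarith [bil_nonpos_of_neg hneg d, hZ v]

/-- Strict dualization of a quadratic matrix inequality. -/
theorem bil_inv_neg (hN : N.IsSymm)
    (hneg : ∀ d, d ≠ 0 → bil N (Sum.elim (0 : a → ℝ) d) (Sum.elim (0 : a → ℝ) d) < 0)
    {Z : Matrix b a ℝ}
    (hZ : ∀ v, v ≠ 0 → 0 < bil N (Sum.elim v (Z *ᵥ v)) (Sum.elim v (Z *ᵥ v)))
    {w : b → ℝ} (hw : w ≠ 0) :
    bil N⁻¹ (Sum.elim (-(Zᵀ *ᵥ w)) w) (Sum.elim (-(Zᵀ *ᵥ w)) w) < 0 := by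
  obtain ⟨v, d, hvd, h⟩ := exists_bil_inv_eq hN (isUnit_det_of_bil hN hneg hZ) Z w
  by_cases hv0 : v = 0
  · have := hneg d (hvd hw hv0)
    rw [hv0] at h
    simp only [mulVec_zero, Sum.elim_zero_zero, bil_zero_left] at h
    linarith
  · linarith [bil_nonpos_of_neg hneg d, hZ v hv0]

/-- The converse dualization. -/
theorem bil_nonneg_of_bil_inv_nonpos (hN : N.IsSymm)
    (hneg : ∀ d, d ≠ 0 → bil N (Sum.elim (0 : a → ℝ) d) (Sum.elim (0 : a → ℝ) d) < 0)
    {S₀ : Matrix b a ℝ}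
    (hpos : ∀ v, v ≠ 0 → 0 < bil N (Sum.elim v (S₀ *ᵥ v)) (Sum.elim v (S₀ *ᵥ v)))
    {Z : Matrix b a ℝ}
    (hZ : ∀ w, bil N⁻¹ (Sum.elim (-(Zᵀ *ᵥ w)) w) (Sum.elim (-(Zᵀ *ᵥ w)) w) ≤ 0) (v : a → ℝ) :
    0 ≤ bil N (Sum.elim v (Z *ᵥ v)) (Sum.elim v (Z *ᵥ v)) := by
  have hdet := isUnit_det_of_bil hN hneg hpos
  have hsymm : N⁻¹.IsSymm := by rw [IsSymm, transpose_nonsing_inv, hN.eq]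
  set u := Sum.elim v (Z *ᵥ v) with hu
  set w := (N *ᵥ u) ∘ Sum.inr with hw
  set c := (N *ᵥ u) ∘ Sum.inl + Zᵀ *ᵥ w with hc
  -- The vectors Nu and (-Zᵀw, w) are N⁻¹-orthogonal, so the form at u equals N⁻¹ at (c, 0), which
  -- is nonnegative, minus N⁻¹ at (-Zᵀw, w), which is nonpositive.
  have hdec : Sum.elim c 0 = N *ᵥ u + (-1 : ℝ) • Sum.elim (-(Zᵀ *ᵥ w)) w := by
    ext (i | i) <;> simp [hc, hw]
  have h1 : bil N⁻¹ (N *ᵥ u) (Sum.elim (-(Zᵀ *ᵥ w)) w) = 0 := by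
    rw [bil_inv_mulVec hN hdet, hu, dotProduct_orthogonal]
  have h2 := bil_add_smul_self hsymm (N *ᵥ u) (Sum.elim (-(Zᵀ *ᵥ w)) w) (-1)
  rw [← hdec, h1, bil_inv_mulVec hN hdet] at h2
  have h3 : 0 ≤ bil N⁻¹ (Sum.elim c 0) (Sum.elim c 0) := by
    by_cases hc0 : c = 0
    · simp [hc0]
    · exact (bil_inv_pos hN hneg hpos hc0).le
  change 0 ≤ u ⬝ᵥ (N *ᵥ u)
  linarith [hZ w]

end Duality

/-! ### Full row rank as a trivial left kernel. -/

section Rank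

lemma rank_eq_card_iff {ι κ : Type*} [Fintype ι] [Fintype κ] (W : Matrix ι κ ℝ) :
    W.rank = Fintype.card ι ↔ ∀ d, Wᵀ *ᵥ d = 0 → d = 0 := by
  rw [rank_eq_finrank_span_row, eq_comm, ← Set.finrank,
    ← linearIndependent_iff_card_eq_finrank_span, ← vecMul_injective_iff,
    ← coe_vecMulLinear, injective_iff_map_eq_zero]
  simp [mulVec_transpose]

end Rank

variable {n m p L : ℕ}

/-! ### Consequences of a bounded noise set. -/

section NoiseModel

lemma isSymm_noiseMatrix {Φ₁₁ : Matrix (Fin n ⊕ Fin p) (Fin n ⊕ Fin p) ℝ}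
    {Φ₁₂ : Matrix (Fin n ⊕ Fin p) (Fin L) ℝ} {Φ₂₂ : Matrix (Fin L) (Fin L) ℝ}
    (h₁ : Φ₁₁.IsSymm) (h₂ : Φ₂₂.IsSymm) : (noiseMatrix Φ₁₁ Φ₁₂ Φ₂₂).IsSymm :=
  h₁.fromBlocks rfl h₂

lemma bil_quadForm {a b : Type*} [Fintype a] [DecidableEq a] [Fintype b]
    (M : Matrix (a ⊕ b) (a ⊕ b) ℝ) (S : Matrix b a ℝ) (v : a → ℝ) :
    bil (quadForm M S) v v = bil M (Sum.elim v (S *ᵥ v)) (Sum.elim v (S *ᵥ v)) := by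
  have h := bil_congr (fromRows (1 : Matrix a a ℝ) S)ᵀ M (fromRows (1 : Matrix a a ℝ) S)ᵀ v v
  rwa [transpose_transpose, fromRows_mulVec, one_mulVec] at h

lemma isSymm_congr {ι κ : Type*} [Fintype ι] {M : Matrix ι ι ℝ} (hM : M.IsSymm)
    (F : Matrix κ ι ℝ) : (F * M * Fᵀ).IsSymm := by
  rw [IsSymm, transpose_mul, transpose_mul, transpose_transpose, hM.eq, Matrix.mul_assoc]

lemma isSymm_quadForm {a b : Type*} [Fintype a] [DecidableEq a] [Fintype b]
    {M : Matrix (a ⊕ b) (a ⊕ b) ℝ} (hM : M.IsSymm) (S : Matrix b a ℝ) :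
    (quadForm M S).IsSymm := by
  have h := isSymm_congr hM (fromRows (1 : Matrix a a ℝ) S)ᵀ
  rwa [transpose_transpose] at h

variable {Φ : Matrix ((Fin n ⊕ Fin p) ⊕ Fin L) ((Fin n ⊕ Fin p) ⊕ Fin L) ℝ}

lemma mem_noiseModel_iff (hΦ : Φ.IsSymm) (Z : Matrix (Fin n ⊕ Fin p) (Fin L) ℝ) :
    Z ∈ noiseModel Φ ↔ ∀ v, 0 ≤ bil Φ (Sum.elim v (Zᵀ *ᵥ v)) (Sum.elim v (Zᵀ *ᵥ v)) := by
  rw [noiseModel, Set.mem_ofPred_eq, posSemidef_iff_bil]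
  simp [isSymm_quadForm hΦ, bil_quadForm]

/-- A nonempty bounded noise model forces the lower right block of `Φ` to be negative definite. -/
theorem bil_neg_of_isBoundedSet (hn : 1 ≤ n) (hΦ : Φ.IsSymm) (hbdd : IsBoundedSet (noiseModel Φ))
    (hne : (noiseModel Φ).Nonempty) {d : Fin L → ℝ} (hd : d ≠ 0) :
    bil Φ (Sum.elim (0 : Fin n ⊕ Fin p → ℝ) d) (Sum.elim (0 : Fin n ⊕ Fin p → ℝ) d) < 0 := by
  by_contra! h
  obtain ⟨Z, hZ⟩ := hne
  obtain ⟨c, hc⟩ := hbdd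
  obtain ⟨g, hg⟩ := exists_dotProduct_eq_bil Φ Zᵀ (Sum.elim (0 : Fin n ⊕ Fin p → ℝ) d)
  -- Along Z + t ω dᵀ the cross term is 2t(ω ⬝ᵥ v)(g ⬝ᵥ v); taking ω = g, or any nonzero ω if g = 0,
  -- keeps it nonnegative for t ≥ 0, so the whole ray stays in the noise set.
  obtain ⟨ω, hω, hωg⟩ : ∃ ω : Fin n ⊕ Fin p → ℝ, ω ≠ 0 ∧ ∀ v, 0 ≤ (ω ⬝ᵥ v) * (g ⬝ᵥ v) := by
    by_cases hg0 : g = 0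
    · exact ⟨1, fun h1 => one_ne_zero (congrFun h1 (Sum.inl ⟨0, hn⟩)), fun v => by simp [hg0]⟩
    · exact ⟨g, hg0, fun v => mul_self_nonneg _⟩
  have hmem : ∀ t : ℝ, 0 ≤ t → Z + t • vecMulVec ω d ∈ noiseModel Φ := by
    intro t ht
    rw [mem_noiseModel_iff hΦ] at hZ ⊢
    intro v
    have h1 : (Sum.elim v ((Z + t • vecMulVec ω d)ᵀ *ᵥ v) : (Fin n ⊕ Fin p) ⊕ Fin L → ℝ) =
        Sum.elim v (Zᵀ *ᵥ v) + (t * (ω ⬝ᵥ v)) • Sum.elim (0 : Fin n ⊕ Fin p → ℝ) d := by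
      rw [transpose_add, transpose_smul, transpose_vecMulVec, add_mulVec, smul_mulVec,
        vecMulVec_mulVec]
      ext (i | i)
      · simp
      · simp [mul_assoc]
    rw [h1, bil_add_smul_self hΦ, ← hg]
    have h2 := hZ v
    have h3 := mul_nonneg ht (hωg v)
    have h4 := mul_nonneg (sq_nonneg (t * (ω ⬝ᵥ v))) h
    linarith
  obtain ⟨i, hi⟩ := Function.ne_iff.1 hω
  obtain ⟨j, hj⟩ := Function.ne_iff.1 hd
  have hij : 0 < |ω i * d j| := abs_pos.2 (mul_ne_zero hi hj)
  have hc0 : 0 ≤ c := (abs_nonneg _).trans (hc Z hZ i j)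
  -- This t moves the (i, j) entry by 2c + 1, more than two entries bounded by c can differ.
  have ht : 0 ≤ (2 * c + 1) / |ω i * d j| := by positivity
  have h1 := hc _ (hmem _ ht) i j
  have h2 := hc Z hZ i j
  have h3 : |(2 * c + 1) / |ω i * d j| * (ω i * d j)| = 2 * c + 1 := by
    rw [abs_mul, abs_of_nonneg ht, div_mul_cancel₀ _ hij.ne']
  rw [Matrix.add_apply, Matrix.smul_apply, vecMulVec_apply, smul_eq_mul] at h1
  have h4 := abs_sub_abs_le_abs_sub ((2 * c + 1) / |ω i * d j| * (ω i * d j)) (-Z i j)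
  rw [h3, abs_neg, sub_neg_eq_add, add_comm _ (Z i j)] at h4
  linarith

end NoiseModel

/-! ### Explaining systems as solutions of the inequality of N. -/

section DataMatrix

variable {Φ : Matrix ((Fin n ⊕ Fin p) ⊕ Fin L) ((Fin n ⊕ Fin p) ⊕ Fin L) ℝ}
  {U : Matrix (Fin m) (Fin L) ℝ} {X : Matrix (Fin n) (Fin (L + 1)) ℝ}
  {Y : Matrix (Fin p) (Fin L) ℝ}

lemma bil_dataMatrix (v : Fin n ⊕ Fin p → ℝ) (d : Fin n ⊕ Fin m → ℝ) :
    bil (dataMatrix Φ U X Y) (Sum.elim v d) (Sum.elim v d) =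
      bil Φ
        (Sum.elim v ((fromRows (statePlus X) Y)ᵀ *ᵥ v - (fromRows (stateMinus X) U)ᵀ *ᵥ d))
        (Sum.elim v ((fromRows (statePlus X) Y)ᵀ *ᵥ v - (fromRows (stateMinus X) U)ᵀ *ᵥ d)) := by
  have h : (dataFactor U X Y)ᵀ *ᵥ Sum.elim v d =
      Sum.elim v ((fromRows (statePlus X) Y)ᵀ *ᵥ v - (fromRows (stateMinus X) U)ᵀ *ᵥ d) := by
    rw [dataFactor, fromBlocks_transpose, fromBlocks_mulVec]
    simp [-fromRows_neg, sub_eq_add_neg, transpose_neg, neg_mulVec]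
  rw [dataMatrix, bil_congr, h]

/-- The transposed data factor maps (v, Tv) to (v, Zᵀv), where Z is the residual of the system with
transpose T. -/
lemma mem_explainingSystems_iff (hΦ : Φ.IsSymm) (S : LinSys n m p) :
    S ∈ explainingSystems Φ U X Y ↔ ∀ v, 0 ≤ bil (dataMatrix Φ U X Y)
      (Sum.elim v (S.toMatrixᵀ *ᵥ v)) (Sum.elim v (S.toMatrixᵀ *ᵥ v)) := by
  rw [explainingSystems, Set.mem_ofPred_eq, mem_noiseModel_iff hΦ]
  simp only [bil_dataMatrix, transpose_sub, transpose_mul, sub_mulVec, mulVec_mulVec]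

/-- The system with a prescribed block matrix `[A, B; C, D]`. -/
def LinSys.ofMatrix (T : Matrix (Fin n ⊕ Fin p) (Fin n ⊕ Fin m) ℝ) : LinSys n m p :=
  ⟨T.toBlocks₁₁, T.toBlocks₁₂, T.toBlocks₂₁, T.toBlocks₂₂⟩

@[simp] lemma LinSys.toMatrix_ofMatrix (T : Matrix (Fin n ⊕ Fin p) (Fin n ⊕ Fin m) ℝ) :
    (LinSys.ofMatrix T).toMatrix = T := fromBlocks_toBlocks T

end DataMatrix

/-! ### Lyapunov inequalities and the conditions on P and Q. -/

section Gramian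

lemma posDef_neg_lyapunov_iff {ι κ : Type*} [Fintype ι] [Fintype κ] {P : Matrix ι ι ℝ}
    (hP : P.IsSymm) (F : Matrix ι ι ℝ) (G : Matrix κ ι ℝ) :
    (-(Fᵀ * P * F - P + Gᵀ * G)).PosDef ↔
      ∀ v, v ≠ 0 → bil P (F *ᵥ v) (F *ᵥ v) + G *ᵥ v ⬝ᵥ G *ᵥ v < bil P v v := by
  have hF := isSymm_congr hP Fᵀ
  rw [transpose_transpose] at hF
  have hsymm : (-(Fᵀ * P * F - P + Gᵀ * G)).IsSymm :=
    ((hF.sub hP).add (by rw [IsSymm, transpose_mul, transpose_transpose])).neg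
  rw [posDef_iff_bil]
  simp only [hsymm, true_and]
  refine forall₂_congr fun v _ => ?_
  have h1 := bil_congr Fᵀ P Fᵀ v v
  have h2 : bil (Gᵀ * G) v v = G *ᵥ v ⬝ᵥ G *ᵥ v := by
    rw [bil, ← mulVec_mulVec, dotProduct_mulVec, vecMul_transpose]
  rw [transpose_transpose] at h1
  rw [bil_neg, bil_add, bil_sub, h1, h2]
  constructor <;> intro h <;> linarith

lemma isCtrbGramian_iff (S : LinSys n m p) (P : Matrix (Fin n) (Fin n) ℝ) :
    IsCtrbGramian S P ↔ P.PosDef ∧ ∀ v, v ≠ 0 →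
      bil P (S.Aᵀ *ᵥ v) (S.Aᵀ *ᵥ v) + S.Bᵀ *ᵥ v ⬝ᵥ S.Bᵀ *ᵥ v < bil P v v := by
  refine and_congr_right fun hP => ?_
  simpa using posDef_neg_lyapunov_iff (isHermitian_iff_isSymm.1 hP.1) S.Aᵀ S.Bᵀ

lemma isObsvGramian_iff (S : LinSys n m p) (Q : Matrix (Fin n) (Fin n) ℝ) :
    IsObsvGramian S Q ↔ Q.PosDef ∧ ∀ v, v ≠ 0 →
      bil Q (S.A *ᵥ v) (S.A *ᵥ v) + S.C *ᵥ v ⬝ᵥ S.C *ᵥ v < bil Q v v :=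
  and_congr_right fun hQ => posDef_neg_lyapunov_iff (isHermitian_iff_isSymm.1 hQ.1) S.A S.C

/-- Restriction to (v, 0) discards C and D, whence the zero block row of `selector`. -/
lemma LinSys.transpose_toMatrix_mulVec (S : LinSys n m p) (v : Fin n → ℝ) :
    S.toMatrixᵀ *ᵥ Sum.elim v 0 = Sum.elim (S.Aᵀ *ᵥ v) (S.Bᵀ *ᵥ v) := by
  rw [LinSys.toMatrix, fromBlocks_transpose, fromBlocks_mulVec]
  simp

lemma LinSys.toMatrix_mulVec (S : LinSys n m p) (v : Fin n → ℝ) :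
    S.toMatrix *ᵥ Sum.elim v 0 = Sum.elim (S.A *ᵥ v) (S.C *ᵥ v) := by
  rw [LinSys.toMatrix, fromBlocks_mulVec]
  simp

lemma isSymm_gramBlock {P : Matrix (Fin n) (Fin n) ℝ} (hP : P.IsSymm) (k : ℕ) :
    (gramBlock k P).IsSymm :=
  hP.fromBlocks (transpose_zero) (hP.neg.fromBlocks transpose_zero isSymm_one.neg)

lemma bil_gramBlock (P : Matrix (Fin n) (Fin n) ℝ) (v x : Fin n → ℝ) (y : Fin m → ℝ) :
    bil (gramBlock m P) (Sum.elim v (Sum.elim x y)) (Sum.elim v (Sum.elim x y)) =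
      bil P v v - (bil P x x + y ⬝ᵥ y) := by
  rw [gramBlock, bil, fromBlocks_mulVec]
  simp only [Sum.elim_comp_inl, Sum.elim_comp_inr, fromBlocks_mulVec, sumElim_dotProduct_sumElim,
    zero_mulVec, add_zero, zero_add, neg_mulVec, one_mulVec, dotProduct_neg, bil]
  ring

lemma bil_ctrbMatrix (K : Matrix ((Fin n ⊕ Fin p) ⊕ (Fin n ⊕ Fin m))
    ((Fin n ⊕ Fin p) ⊕ (Fin n ⊕ Fin m)) ℝ) (v : Fin n → ℝ) (c : Fin n ⊕ Fin m → ℝ) :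
    bil (ctrbMatrix K) (Sum.elim v c) (Sum.elim v c) =
      bil K (Sum.elim (Sum.elim v 0) c) (Sum.elim (Sum.elim v 0) c) := by
  have h : selector n p m *ᵥ Sum.elim v c = Sum.elim (Sum.elim v 0) c := by
    rw [selector, fromBlocks_mulVec]
    simp [fromRows_mulVec]
  have h' := bil_congr (selector n p m)ᵀ K (selector n p m)ᵀ (Sum.elim v c) (Sum.elim v c)
  rwa [transpose_transpose, h] at h'

lemma isSymm_ctrbMatrix {K : Matrix ((Fin n ⊕ Fin p) ⊕ (Fin n ⊕ Fin m))
    ((Fin n ⊕ Fin p) ⊕ (Fin n ⊕ Fin m)) ℝ} (hK : K.IsSymm) : (ctrbMatrix K).IsSymm := by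
  have h := isSymm_congr hK (selector n p m)ᵀ
  rwa [transpose_transpose] at h

variable {K : Matrix ((Fin n ⊕ Fin p) ⊕ (Fin n ⊕ Fin m)) ((Fin n ⊕ Fin p) ⊕ (Fin n ⊕ Fin m)) ℝ}
  {P : Matrix (Fin n) (Fin n) ℝ}

lemma lyapunov_lt_of_posDef_sub_smul {α : ℝ} (hα : 0 < α)
    (h : (gramBlock m P - α • ctrbMatrix K).PosDef)
    {T : Matrix (Fin n ⊕ Fin m) (Fin n ⊕ Fin p) ℝ}
    (hT : ∀ v, 0 ≤ bil K (Sum.elim v (T *ᵥ v)) (Sum.elim v (T *ᵥ v)))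
    {v x : Fin n → ℝ} {y : Fin m → ℝ} (hv : v ≠ 0) (hTv : T *ᵥ Sum.elim v 0 = Sum.elim x y) :
    bil P x x + y ⬝ᵥ y < bil P v v := by
  have h0 : (Sum.elim v (Sum.elim x y) : Fin n ⊕ (Fin n ⊕ Fin m) → ℝ) ≠ 0 := fun h0 =>
    hv (funext fun i => congrFun h0 (Sum.inl i))
  have h1 := (posDef_iff_bil.1 h).2 _ h0
  rw [bil_sub, bil_smul, bil_gramBlock, bil_ctrbMatrix, ← hTv] at h1
  nlinarith [mul_nonneg hα.le (hT (Sum.elim v 0))]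

/-- Every vector with v ≠ 0 and nonnegative K-form comes from a solution T, which reduces the claim
to the strict S-lemma. K is arbitrary so that both N and its dual are covered. -/
lemma exists_posDef_gramBlock_sub_smul (hn : 1 ≤ n) (hK : K.IsSymm)
    (hneg : ∀ d, d ≠ 0 → bil K (Sum.elim (0 : Fin n ⊕ Fin p → ℝ) d)
      (Sum.elim (0 : Fin n ⊕ Fin p → ℝ) d) < 0)
    {S₀ : Matrix (Fin n ⊕ Fin m) (Fin n ⊕ Fin p) ℝ}
    (hpos : ∀ v, v ≠ 0 → 0 < bil K (Sum.elim v (S₀ *ᵥ v)) (Sum.elim v (S₀ *ᵥ v)))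
    (hP : P.PosDef)
    (h : ∀ T : Matrix (Fin n ⊕ Fin m) (Fin n ⊕ Fin p) ℝ,
      (∀ v, 0 ≤ bil K (Sum.elim v (T *ᵥ v)) (Sum.elim v (T *ᵥ v))) →
      ∀ (v x : Fin n → ℝ) (y : Fin m → ℝ), v ≠ 0 → T *ᵥ Sum.elim v 0 = Sum.elim x y →
        bil P x x + y ⬝ᵥ y < bil P v v) :
    ∃ α : ℝ, 0 < α ∧ (gramBlock m P - α • ctrbMatrix K).PosDef := by
  have hPsymm := isHermitian_iff_isSymm.1 hP.1
  have hinl : ∀ v : Fin n → ℝ, v ≠ 0 → (Sum.elim v 0 : Fin n ⊕ Fin p → ℝ) ≠ 0 :=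
    fun v hv h0 => hv (funext fun i => congrFun h0 (Sum.inl i))
  have hone : (1 : Fin n → ℝ) ≠ 0 := fun h0 => one_ne_zero (congrFun h0 ⟨0, hn⟩)
  obtain ⟨α, hα⟩ := exists_posDef_sub_smul (isSymm_gramBlock hPsymm m) (isSymm_ctrbMatrix hK)
    ⟨Sum.elim 1 (S₀ *ᵥ Sum.elim 1 0), by
      rw [bil_ctrbMatrix]; exact hpos _ (hinl _ hone)⟩ (by
    intro u hu hKu
    obtain ⟨v, x, y, rfl⟩ : ∃ v x y, u = Sum.elim v (Sum.elim x y) :=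
      ⟨u ∘ Sum.inl, u ∘ Sum.inr ∘ Sum.inl, u ∘ Sum.inr ∘ Sum.inr, by
        ext (i | i | i) <;> rfl⟩
    rw [bil_ctrbMatrix] at hKu
    have hv : v ≠ 0 := by
      rintro rfl
      rw [Sum.elim_zero_zero] at hKu
      by_cases hd : (Sum.elim x y : Fin n ⊕ Fin m → ℝ) = 0
      · exact hu (by rw [hd, Sum.elim_zero_zero])
      · exact absurd hKu (not_le.2 (hneg _ hd))
    obtain ⟨T, hTv, hT⟩ := exists_mulVec_eq_of_bil_nonneg hK hneg hpos (hinl v hv) hKu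
    rw [bil_gramBlock]
    linarith [h T hT v x y hv hTv])
  refine ⟨α, ?_, hα⟩
  have h0 : (Sum.elim 1 0 : Fin n ⊕ Fin m → ℝ) ≠ 0 :=
    fun h0 => hone (funext fun i => congrFun h0 (Sum.inl i))
  -- Positivity of α: at (0, (1, 0)) both the Gramian block and K are negative.
  have h1 := (posDef_iff_bil.1 hα).2 (Sum.elim 0 (Sum.elim 1 0)) (fun h1 =>
    h0 (funext fun i => congrFun h1 (Sum.inr i)))
  rw [bil_sub, bil_smul, bil_gramBlock, bil_ctrbMatrix, Sum.elim_zero_zero] at h1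
  have h2 := hneg _ h0
  have h3 := (posDef_iff_bil.1 hP).2 _ hone
  simp only [bil_zero_left, dotProduct_zero, add_zero, zero_sub] at h1
  by_contra! h4
  nlinarith [mul_nonneg_of_nonpos_of_nonpos h4 h2.le]

lemma eq_zero_of_forall_bil_lt {ι : Type*} [Fintype ι] {G : Matrix ι ι ℝ} (hG : G.PosDef)
    {r ξ : ι → ℝ} {c : ℝ} (h : ∀ t : ℝ, bil G (r + t • ξ) (r + t • ξ) < c) : ξ = 0 := by
  rw [posDef_iff_bil] at hG
  by_contra hξ
  have hs := hG.2 ξ hξ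
  have hr : 0 ≤ bil G r r := by
    by_cases hr0 : r = 0
    · simp [hr0]
    · exact (hG.2 r hr0).le
  simp only [bil_add_smul_self hG.1] at h
  have hc : 0 < c := by
    have := h 0
    simp only [mul_zero, zero_mul, ne_eq, OfNat.ofNat_ne_zero, not_false_eq_true, zero_pow,
      add_zero] at this
    linarith
  -- Adding the bounds at t and -t cancels the cross term, and t² G(ξ) ≥ t G(ξ) > c.
  set t := c / bil G ξ ξ + 1 with ht
  have ht1 : 1 ≤ t := by rw [ht]; linarith [div_pos hc hs]
  have hts : t * bil G ξ ξ = c + bil G ξ ξ := by rw [ht]; field_simp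
  have h1 := h t
  have h2 := h (-t)
  nlinarith

/-- Robust Lyapunov inequalities exclude perturbations in an unconstrained direction. -/
lemma eq_zero_of_forall_lyapunov_lt (hn : 1 ≤ n) (hP : P.PosDef)
    {T : Matrix (Fin n ⊕ Fin m) (Fin n ⊕ Fin p) ℝ} {ξ : Fin n ⊕ Fin m → ℝ}
    (h : ∀ (ω : Fin n ⊕ Fin p → ℝ) (v x : Fin n → ℝ) (y : Fin m → ℝ), v ≠ 0 →
      (T + vecMulVec ξ ω) *ᵥ Sum.elim v 0 = Sum.elim x y →
        bil P x x + y ⬝ᵥ y < bil P v v) : ξ = 0 := by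
  let G : Matrix (Fin n ⊕ Fin m) (Fin n ⊕ Fin m) ℝ := fromBlocks P 0 0 1
  have hGbil : ∀ u : Fin n ⊕ Fin m → ℝ, bil G u u =
      bil P (u ∘ Sum.inl) (u ∘ Sum.inl) + u ∘ Sum.inr ⬝ᵥ u ∘ Sum.inr := by
    intro u
    conv_lhs => rw [bil, fromBlocks_mulVec, ← Sum.elim_comp_inl_inr u, sumElim_dotProduct_sumElim]
    simp [bil]
  have hG : G.PosDef := by
    refine posDef_iff_bil.2 ⟨(isHermitian_iff_isSymm.1 hP.1).fromBlocks transpose_zero isSymm_one,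
      fun u hu => ?_⟩
    rw [hGbil]
    by_cases hx : u ∘ Sum.inl = 0
    · have hy : u ∘ Sum.inr ≠ 0 := fun hy => hu (by
        rw [← Sum.elim_comp_inl_inr u, hx, hy, Sum.elim_zero_zero])
      rw [hx, bil_zero_left, zero_add]
      exact dotProduct_self_pos hy
    · have := dotProduct_star_self_nonneg (u ∘ Sum.inr)
      rw [star_trivial] at this
      linarith [(posDef_iff_bil.1 hP).2 _ hx]
  let v : Fin n → ℝ := Pi.single ⟨0, hn⟩ 1
  have hv : v ≠ 0 := fun h0 => by simpa [v] using congrFun h0 ⟨0, hn⟩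
  refine eq_zero_of_forall_bil_lt hG (r := T *ᵥ Sum.elim v 0) (c := bil P v v) fun t => ?_
  rw [hGbil]
  -- As v is a unit vector, ω = (tv, 0) shifts T(v, 0) by exactly tξ.
  refine h (Sum.elim (t • v) 0) v _ _ hv ?_
  rw [Sum.elim_comp_inl_inr, add_mulVec, vecMulVec_mulVec, sumElim_dotProduct_sumElim]
  simp [v]

end Gramian

/-! ### The dual data matrix. -/

section Dual

variable {N : Matrix ((Fin n ⊕ Fin p) ⊕ (Fin n ⊕ Fin m)) ((Fin n ⊕ Fin p) ⊕ (Fin n ⊕ Fin m)) ℝ}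

/-- The right factor is minus the transpose of the left one, so the dual is minus a congruence of
N⁻¹; this sign undoes the reversal in dualization. -/
lemma dualMatrix_eq : dualMatrix N =
    -((fromBlocks 0 (-1) 1 0 :
      Matrix ((Fin n ⊕ Fin m) ⊕ (Fin n ⊕ Fin p)) ((Fin n ⊕ Fin p) ⊕ (Fin n ⊕ Fin m)) ℝ) * N⁻¹ *
    (fromBlocks 0 (-1) 1 0 :
      Matrix ((Fin n ⊕ Fin m) ⊕ (Fin n ⊕ Fin p)) ((Fin n ⊕ Fin p) ⊕ (Fin n ⊕ Fin m)) ℝ)ᵀ) := by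
  rw [dualMatrix, ← Matrix.mul_neg, fromBlocks_transpose, fromBlocks_neg]
  simp

lemma isSymm_dualMatrix (hN : N.IsSymm) : (dualMatrix N).IsSymm := by
  rw [dualMatrix_eq]
  exact (isSymm_congr (by rw [IsSymm, transpose_nonsing_inv, hN.eq]) _).neg

lemma bil_dualMatrix (w : Fin n ⊕ Fin m → ℝ) (z : Fin n ⊕ Fin p → ℝ) :
    bil (dualMatrix N) (Sum.elim w z) (Sum.elim w z) =
      -bil N⁻¹ (Sum.elim (-z) w) (Sum.elim (-z) w) := by
  have h : (fromBlocks 0 (-1) 1 0 :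
      Matrix ((Fin n ⊕ Fin m) ⊕ (Fin n ⊕ Fin p)) ((Fin n ⊕ Fin p) ⊕ (Fin n ⊕ Fin m)) ℝ)ᵀ *ᵥ
      Sum.elim w z = -Sum.elim (-z) w := by
    rw [fromBlocks_transpose, fromBlocks_mulVec]
    ext (i | i) <;> simp [neg_mulVec]
  rw [dualMatrix_eq, bil_neg, bil_congr, h, bil_neg_left, bil_neg_right, neg_neg]

end Dual

end GLB

/-! ### The equivalence. -/

open GLB

theorem theorem2 (n m p L : ℕ) (hn : 1 ≤ n)
    (Φ₁₁ : Matrix (Fin n ⊕ Fin p) (Fin n ⊕ Fin p) ℝ)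
    (Φ₁₂ : Matrix (Fin n ⊕ Fin p) (Fin L) ℝ)
    (Φ₂₂ : Matrix (Fin L) (Fin L) ℝ)
    (hΦ₁₁ : Φ₁₁.IsSymm) (hΦ₂₂ : Φ₂₂.IsSymm)
    (Φ : Matrix ((Fin n ⊕ Fin p) ⊕ Fin L) ((Fin n ⊕ Fin p) ⊕ Fin L) ℝ)
    (hΦ : Φ = GLB.noiseMatrix Φ₁₁ Φ₁₂ Φ₂₂)
    (hbdd : GLB.IsBoundedSet (GLB.noiseModel Φ))
    (hint : (interior (GLB.noiseModel Φ)).Nonempty)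
    (U : Matrix (Fin m) (Fin L) ℝ)
    (X : Matrix (Fin n) (Fin (L + 1)) ℝ)
    (Y : Matrix (Fin p) (Fin L) ℝ)
    (N : Matrix ((Fin n ⊕ Fin p) ⊕ (Fin n ⊕ Fin m))
      ((Fin n ⊕ Fin p) ⊕ (Fin n ⊕ Fin m)) ℝ)
    (hN : N = GLB.dataMatrix Φ U X Y)
    (hslater : GLB.GeneralizedSlater N) :
    GLB.InformativeGLB Φ U X Y ↔
      ((Matrix.fromRows (GLB.stateMinus X) U).rank = n + m ∧
        (∃ (P : Matrix (Fin n) (Fin n) ℝ) (α : ℝ), P.PosDef ∧ 0 < α ∧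
          (GLB.gramBlock m P - α • GLB.ctrbMatrix N).PosDef) ∧
        (∃ (Q : Matrix (Fin n) (Fin n) ℝ) (β : ℝ), Q.PosDef ∧ 0 < β ∧
          (GLB.gramBlock p Q - β • GLB.obsvMatrix N).PosDef)) := by
  have hΦs : Φ.IsSymm := hΦ ▸ isSymm_noiseMatrix hΦ₁₁ hΦ₂₂
  have hNs : N.IsSymm := hN ▸ isSymm_congr hΦs _
  obtain ⟨S₀, hS₀⟩ := hslater
  have hpos : ∀ v, v ≠ 0 → 0 < bil N (Sum.elim v (S₀ *ᵥ v)) (Sum.elim v (S₀ *ᵥ v)) :=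
    fun v hv => by rw [← bil_quadForm]; exact (posDef_iff_bil.1 hS₀).2 v hv
  have hmem : ∀ S : LinSys n m p, S ∈ explainingSystems Φ U X Y ↔
      ∀ v, 0 ≤ bil N (Sum.elim v (S.toMatrixᵀ *ᵥ v)) (Sum.elim v (S.toMatrixᵀ *ᵥ v)) :=
    fun S => hN ▸ mem_explainingSystems_iff hΦs S
  have hrank : (fromRows (stateMinus X) U).rank = n + m ↔
      ∀ d, (fromRows (stateMinus X) U)ᵀ *ᵥ d = 0 → d = 0 := by
    rw [← rank_eq_card_iff, Fintype.card_sum, Fintype.card_fin, Fintype.card_fin]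
  have hneg : (fromRows (stateMinus X) U).rank = n + m → ∀ d, d ≠ 0 →
      bil N (Sum.elim (0 : Fin n ⊕ Fin p → ℝ) d) (Sum.elim (0 : Fin n ⊕ Fin p → ℝ) d) < 0 := by
    intro hr d hd
    rw [hN, bil_dataMatrix]
    refine bil_neg_of_isBoundedSet hn hΦs hbdd (hint.mono interior_subset) fun h0 => hd ?_
    exact hrank.1 hr d (by simpa using h0)
  constructor
  · rintro ⟨P, Q, hP, hQ, hinf⟩
    have hctrb : ∀ T : Matrix (Fin n ⊕ Fin m) (Fin n ⊕ Fin p) ℝ,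
        (∀ v, 0 ≤ bil N (Sum.elim v (T *ᵥ v)) (Sum.elim v (T *ᵥ v))) →
        ∀ (v x : Fin n → ℝ) (y : Fin m → ℝ), v ≠ 0 → T *ᵥ Sum.elim v 0 = Sum.elim x y →
          bil P x x + y ⬝ᵥ y < bil P v v := by
      intro T hT v x y hv hTv
      have h := hinf (LinSys.ofMatrix Tᵀ) ((hmem _).2 (by simpa using hT))
      have h1 := (LinSys.ofMatrix Tᵀ).transpose_toMatrix_mulVec v
      rw [LinSys.toMatrix_ofMatrix, transpose_transpose, hTv, Sum.elim_eq_iff] at h1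
      rw [h1.1, h1.2]
      exact ((isCtrbGramian_iff _ _).1 h.1).2 v hv
    have hr : (fromRows (stateMinus X) U).rank = n + m := by
      -- For ξ in the left kernel, S₀ + ξωᵀ leaves the same residual as S₀ and remains a solution
      -- for every ω.
      refine hrank.2 fun ξ hξ => eq_zero_of_forall_lyapunov_lt hn hP (T := S₀) fun ω => hctrb _ ?_
      intro v
      have h0 : 0 ≤ bil N (Sum.elim v (S₀ *ᵥ v)) (Sum.elim v (S₀ *ᵥ v)) := by
        by_cases hv : v = 0
        · simp [hv]
        · exact (hpos v hv).le
      rw [hN, bil_dataMatrix] at h0 ⊢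
      have h1 : (fromRows (stateMinus X) U)ᵀ *ᵥ ((S₀ + vecMulVec ξ ω) *ᵥ v) =
          (fromRows (stateMinus X) U)ᵀ *ᵥ (S₀ *ᵥ v) := by
        rw [add_mulVec, vecMulVec_mulVec, mulVec_add]
        simp [mulVec_smul, hξ]
      rwa [h1]
    have hneg := hneg hr
    refine ⟨hr, ?_, ?_⟩
    · obtain ⟨α, hα⟩ := exists_posDef_gramBlock_sub_smul hn hNs hneg hpos hP hctrb
      exact ⟨P, α, hP, hα⟩
    -- The dual inherits both sign conditions, with S₀ᵀ as its Slater point.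
    · have hnegD : ∀ z, z ≠ 0 → bil (dualMatrix N) (Sum.elim (0 : Fin n ⊕ Fin m → ℝ) z)
          (Sum.elim (0 : Fin n ⊕ Fin m → ℝ) z) < 0 := by
        intro z hz
        rw [bil_dualMatrix, neg_lt_zero]
        exact bil_inv_pos hNs hneg hpos (neg_ne_zero.2 hz)
      have hposD : ∀ w, w ≠ 0 → 0 < bil (dualMatrix N) (Sum.elim w (S₀ᵀ *ᵥ w))
          (Sum.elim w (S₀ᵀ *ᵥ w)) := by
        intro w hw
        rw [bil_dualMatrix, neg_pos]
        exact bil_inv_neg hNs hneg hpos hw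
      obtain ⟨β, hβ⟩ := exists_posDef_gramBlock_sub_smul hn (isSymm_dualMatrix hNs) hnegD hposD hQ
        (by
          intro T hT v x y hv hTv
          have hTN := bil_nonneg_of_bil_inv_nonpos hNs hneg hpos (Z := Tᵀ) fun w => by
            have h := hT w
            rw [bil_dualMatrix, neg_nonneg] at h
            rwa [transpose_transpose]
          have h := hinf (LinSys.ofMatrix T) ((hmem _).2 (by simpa using hTN))
          have h1 := (LinSys.ofMatrix T).toMatrix_mulVec v
          rw [LinSys.toMatrix_ofMatrix, hTv, Sum.elim_eq_iff] at h1
          rw [h1.1, h1.2]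
          exact ((isObsvGramian_iff _ _).1 h.2).2 v hv)
      exact ⟨Q, β, hQ, hβ⟩
  · rintro ⟨hr, ⟨P, α, hP, hα, hPα⟩, Q, β, hQ, hβ, hQβ⟩
    have hneg := hneg hr
    refine ⟨P, Q, hP, hQ, fun S hS => ?_⟩
    rw [hmem] at hS
    refine ⟨(isCtrbGramian_iff _ _).2 ⟨hP, fun v hv => ?_⟩,
      (isObsvGramian_iff _ _).2 ⟨hQ, fun v hv => ?_⟩⟩
    · exact lyapunov_lt_of_posDef_sub_smul hα hPα hS hv (S.transpose_toMatrix_mulVec v)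
    · refine lyapunov_lt_of_posDef_sub_smul hβ hQβ (fun w => ?_) hv (S.toMatrix_mulVec v)
      have h := bil_inv_nonpos hNs (isUnit_det_of_bil hNs hneg hpos) hneg hS w
      rwa [transpose_transpose, ← neg_nonneg, ← bil_dualMatrix] at h
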